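/- Let $V$ be a finite set and let $\mathcal L=\{x\in[0,\infty)^V:\|x\|_\infty>1\}$. A random vector $Y=(Y_i)_{i\in V}$ has a multivariate Pareto distribution if $Y\in\mathcal L$ almost surely, $\mathbb P(Y\in tA)=t^{-1}\,\mathbb P(Y\in A)$ for all $t\ge 1$ and all Borel sets $A\subseteq\mathcal L$, and the margins are normalized so that $\mathbb P(Y_i>1)$ is the same for all $i\in V$. For $m\in V$ let $Y^m$ denote $Y$ conditioned on the event $\{Y_m>1\}$. For pairwise disjoint $A,B,C\subseteq V$ write $Y_A\perp_e Y_C\mid Y_B$ if $Y^m_A$ and $Y^m_C$ are conditionally independent given $Y^m_B$ for every $m\in V$. A multivariate Pareto vector $Y$ is an extremal graphical model on a graph $G$ with node set $V$ if $Y_A\perp_e Y_C\mid Y_B$ for all pairwise disjoint $A,B,C\subseteq V$ such that every path in $G$ from $A$ to $C$ contains a node of $B$. The extremal variogram rooted at $m\in V$ is the matrix $$\Gamma^{(m)}_{ij}=\operatorname{Var}\{\log Y^m_i-\log Y^m_j\},\qquad i,j\in V,$$ which is said to exist if, for all $i,j\in V$, $\log Y^m_i-\log Y^m_j$ is almost surely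 well defined and finite and has finite variance (in particular $Y^m_i>0$ almost surely for every $i$). Let $Y$ be an extremal graphical model on a tree $T=(V,E)$ and suppose that $\Gamma^{(m)}$ exists for every $m\in V$. Then for all $m\in V$ and all $i\neq j$ in $V$, $\mathbb P(Y_i\neq Y_j)>0$ if and only if $\Gamma^{(m)}_{ij}>0$. If moreover $\mathbb P(Y_i\ne Y_j)>0$ for all $i\ne j$ in $V$, then for every $m\in V$ the minimum spanning tree with weights $\rho_{ij}=\Gamma^{(m)}_{ij}$, that is, the tree $T'=(V,E')$ minimizing $\sum_{\{i,j\}\in E'}\Gamma^{(m)}_{ij}$ among all trees with node set $V$, is unique and equals $T$. -/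

import Mathlib

open MeasureTheory ProbabilityTheory
open scoped Pointwise

noncomputable section

namespace ExtremalTree

variable {V : Type*} [Fintype V] {Ω : Type*} [MeasurableSpace Ω]

/-- The set `𝓛 = {x ≥ 0 : ‖x‖_∞ > 1}` (the norm of `V → ℝ` is the maximum norm). -/
def supportSet (V : Type*) [Fintype V] : Set (V → ℝ) :=
  {x | (∀ i, 0 ≤ x i) ∧ 1 < ‖x‖}

/-- The random vector `Y` has a multivariate Pareto distribution (with normalized margins):
it takes values in `𝓛`, it is homogeneous, `ℙ(Y ∈ t A) = t⁻¹ ℙ(Y ∈ A)` for `t ≥ 1` and all Borel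
sets `A ⊆ 𝓛`, and all its components exceed `1` with the same probability. -/
structure IsMultivariatePareto (P : Measure Ω) (Y : Ω → V → ℝ) : Prop where
  mem_supportSet : ∀ᵐ ω ∂P, Y ω ∈ supportSet V
  homogeneous : ∀ t : ℝ, 1 ≤ t → ∀ A : Set (V → ℝ), MeasurableSet A → A ⊆ supportSet V →
    P.real {ω | Y ω ∈ t • A} = t⁻¹ * P.real {ω | Y ω ∈ A}
  normalized : ∀ i j : V, P.real {ω | 1 < Y ω i} = P.real {ω | 1 < Y ω j}

/-- The law of `Y^m`, that is, of `Y` conditioned on the event `{Y_m > 1}`. -/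
def exceedanceLaw (P : Measure Ω) (Y : Ω → V → ℝ) (m : V) : Measure (V → ℝ) :=
  (P[|{ω | 1 < Y ω m}]).map Y

instance (P : Measure Ω) (Y : Ω → V → ℝ) (m : V) : IsFiniteMeasure (exceedanceLaw P Y m) := by
  unfold exceedanceLaw; infer_instance

/-- The projection `x ↦ x_A`. -/
def proj (A : Set V) (x : V → ℝ) : A → ℝ := fun a => x a

theorem measurable_proj {V : Type*} (A : Set V) : Measurable (proj A) :=
  measurable_pi_lambda _ fun a => measurable_pi_apply (a : V)

/-- Extremal conditional independence `Y_A ⊥_e Y_C ∣ Y_B`: for every `m ∈ V`, the vectors `Y^m_A`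
and `Y^m_C` are conditionally independent given `Y^m_B` (in the usual sense; this depends on the
law of `Y^m` only, and is read on the canonical space `V → ℝ` with that law). -/
def ExtremalCondIndep (P : Measure Ω) (Y : Ω → V → ℝ) (A B C : Set V) : Prop :=
  ∀ m : V, CondIndepFun (MeasurableSpace.comap (proj B) inferInstance)
    (measurable_proj B).comap_le (proj A) (proj C) (exceedanceLaw P Y m)

/-- `B` separates `A` and `C` in `G`: every path from `A` to `C` contains a node in `B`. -/
def Separates (G : SimpleGraph V) (A B C : Set V) : Prop :=
  ∀ a ∈ A, ∀ c ∈ C, ∀ p : G.Walk a c, p.IsPath → ∃ v ∈ p.support, v ∈ B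

/-- `Y` is an extremal graphical model on `G`: a multivariate Pareto distribution which satisfies
the global Markov property on `G` with respect to `⊥_e`. -/
structure IsExtremalGraphicalModel (P : Measure Ω) (Y : Ω → V → ℝ) (G : SimpleGraph V) :
    Prop where
  pareto : IsMultivariatePareto P Y
  globalMarkov : ∀ A B C : Set V, Disjoint A B → Disjoint A C → Disjoint B C →
    Separates G A B C → ExtremalCondIndep P Y A B C

/-- The extremal variogram rooted at `m`, `Γ^(m)_ij = Var(log Y^m_i - log Y^m_j)`. -/
def extremalVariogram (P : Measure Ω) (Y : Ω → V → ℝ) (m : V) : Matrix V V ℝ := fun i j =>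
  variance (fun x : V → ℝ => Real.log (x i) - Real.log (x j)) (exceedanceLaw P Y m)

/-- The matrix `Γ^(m)` exists: for all `i, j` the random variable `log Y^m_i - log Y^m_j` is almost
surely well defined (so that no component vanishes) and has a finite variance. -/
def VariogramExists (P : Measure Ω) (Y : Ω → V → ℝ) (m : V) : Prop :=
  ∀ i j : V, (∀ᵐ x ∂exceedanceLaw P Y m, 0 < x i ∧ 0 < x j) ∧
    MemLp (fun x : V → ℝ => Real.log (x i) - Real.log (x j)) 2 (exceedanceLaw P Y m)

theorem extremalVariogram_symm {V : Type*} (P : Measure Ω) (Y : Ω → V → ℝ) (m i j : V) :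
    extremalVariogram P Y m i j = extremalVariogram P Y m j i := by
  unfold extremalVariogram
  rw [← variance_neg]
  congr 1
  ext x
  simp

/-- The weights `ρ_ij = Γ^(m)_ij` on unordered pairs of nodes. -/
def variogramWeight (P : Measure Ω) (Y : Ω → V → ℝ) (m : V) : Sym2 V → ℝ :=
  Sym2.lift ⟨extremalVariogram P Y m, extremalVariogram_symm P Y m⟩

open Classical in
/-- The sum of the weights of the edges of `G`, each unordered edge being counted once. -/
def totalWeight (ρ : Sym2 V → ℝ) (G : SimpleGraph V) : ℝ :=
  ∑ e : Sym2 V with e ∈ G.edgeSet, ρ e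

/-- `T` is a minimum spanning tree on the node set `V` for the weights `ρ`. -/
def IsMinSpanningTree (ρ : Sym2 V → ℝ) (T : SimpleGraph V) : Prop :=
  T.IsTree ∧ ∀ T' : SimpleGraph V, T'.IsTree → totalWeight ρ T ≤ totalWeight ρ T'

end ExtremalTree

end

/-! The heart of the matter is that `Γ^(m)` is additive along the paths of `T`
(`extremalVariogram_add_of_mem_support`). Let `s` lie strictly between `i` and `j`, and let `s`
separate `A ∋ i` from `C ∋ j`; by symmetry take `m ∈ A ∪ {s}`. Given `Y_s > 1`, homogeneity makes
`Y_j / Y_s` independent of `Y_s`, and the Markov property improves this to independence of `(Y_s,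
Y_A)`. Rescaling carries the independence of `Y_i / Y_s` and `Y_j / Y_s` over to the event `Y_m > 1`
(`indepFun_quotients`), so the variances of the log-increments add.

A zero variance means `Y_i = c Y_j` given `Y_m > 1`. Homogeneity spreads this over the whole
support, and the equal Pareto margins force `c = 1` (`ae_eq_of_proportional`).

For the spanning tree, additivity turns the weight of any tree `T'` into `∑ n_f ρ_f` over the edges
`f` of `T`, where `n_f` counts the edges of `T'` whose `T`-path uses `f`. Connectedness of `T'`
gives `n_f ≥ 1`, hence minimality of `T`. In case of equality all `n_f` are `1`, and counting edges
shows that every edge of `T'` is an edge of `T` (`totalWeight_le_of_isTree`). -/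

namespace ExtremalTree

/-! ### Path-additive weights on a tree and minimum spanning trees. -/

section TreeMetric

variable {V : Type*} {T : SimpleGraph V} {ρ : Sym2 V → ℝ}

open Classical in
/-- The edges of `T` whose removal disconnects the endpoints of `e`; for a tree `T` these are the
edges on the path between the endpoints. -/
noncomputable def cutEdges [Fintype V] (T : SimpleGraph V) (e : Sym2 V) : Finset (Sym2 V) :=
  {f | f ∈ T.edgeSet ∧ ∀ i j, e = s(i, j) → ¬ (T.deleteEdges {f}).Reachable i j}

/-- Paths in an acyclic graph are unique, so every walk from `i` to `j` runs through all edges of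
`p`. The right-hand side does not mention `p`, which lets `cutEdges` be defined on unordered pairs.
-/
theorem mem_edges_iff_not_reachable (hT : T.IsAcyclic) {i j : V} {p : T.Walk i j}
    (hp : p.IsPath) (f : Sym2 V) :
    f ∈ p.edges ↔ ¬ (T.deleteEdges {f}).Reachable i j := by
  classical
  constructor
  · rintro hf ⟨q⟩
    set q' : T.Walk i j := q.mapLe (SimpleGraph.deleteEdges_le {f}) with hq'
    have h1 : f ∉ q'.edges := by
      intro h
      rw [hq', SimpleGraph.Walk.edges_mapLe_eq_edges] at h
      have := q.edges_subset_edgeSet h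
      simp at this
    have h2 : p = q'.toPath := congrArg Subtype.val ((hT.subsingleton_path _ _).elim ⟨p, hp⟩ q'.toPath)
    rw [h2] at hf
    exact h1 (q'.edges_toPath_subset_edges hf)
  · intro h
    by_contra hf
    exact h ⟨p.toDeleteEdge f hf⟩

theorem mem_cutEdges_iff [Fintype V] (hT : T.IsAcyclic) {i j : V} {p : T.Walk i j}
    (hp : p.IsPath) (f : Sym2 V) : f ∈ cutEdges T s(i, j) ↔ f ∈ p.edges := by
  rw [mem_edges_iff_not_reachable hT hp]
  simp only [cutEdges, Finset.mem_filter, Finset.mem_univ, true_and]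
  constructor
  · rintro ⟨-, h⟩
    exact h i j rfl
  · intro h
    refine ⟨p.edges_subset_edgeSet ((mem_edges_iff_not_reachable hT hp f).2 h), ?_⟩
    intro a b hab
    rcases Sym2.eq_iff.1 hab with ⟨rfl, rfl⟩ | ⟨rfl, rfl⟩
    · exact h
    · exact fun h' => h h'.symm

open Classical in
theorem cutEdges_eq_toFinset [Fintype V] (hT : T.IsAcyclic) {i j : V} {p : T.Walk i j}
    (hp : p.IsPath) : cutEdges T s(i, j) = p.edges.toFinset := by
  ext f
  rw [mem_cutEdges_iff hT hp, List.mem_toFinset]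

theorem weight_eq_sum_edges (hdiag : ∀ i, ρ s(i, i) = 0)
    (hadd : ∀ (i j k : V) (p : T.Walk i j), p.IsPath → k ∈ p.support →
      ρ s(i, j) = ρ s(i, k) + ρ s(k, j))
    {i j : V} (p : T.Walk i j) (hp : p.IsPath) : ρ s(i, j) = (p.edges.map ρ).sum := by
  induction p with
  | nil => simp [hdiag]
  | @cons u v w h p ih =>
    rw [hadd u w v _ hp (by simp), ih hp.of_cons]
    simp

theorem weight_eq_sum_cutEdges [Fintype V] (hT : T.IsTree) (hdiag : ∀ i, ρ s(i, i) = 0)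
    (hadd : ∀ (i j k : V) (p : T.Walk i j), p.IsPath → k ∈ p.support →
      ρ s(i, j) = ρ s(i, k) + ρ s(k, j)) (e : Sym2 V) :
    ρ e = ∑ f ∈ cutEdges T e, ρ f := by
  classical
  induction e with
  | _ i j =>
    obtain ⟨p, hp, -⟩ := hT.existsUnique_path i j
    rw [weight_eq_sum_edges hdiag hadd p hp, cutEdges_eq_toFinset hT.isAcyclic hp,
      List.sum_toFinset _ hp.isTrail.edges_nodup]

/-- Every edge of a tree lies on the path between the endpoints of some edge of any given
connected spanning graph. -/
theorem exists_mem_cutEdges [Fintype V] (hT : T.IsAcyclic) {T' : SimpleGraph V}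
    (hT' : T'.Connected) {f : Sym2 V} (hf : f ∈ T.edgeSet) :
    ∃ e ∈ T'.edgeSet, f ∈ cutEdges T e := by
  by_contra! hcon
  induction f with
  | _ a b =>
  -- If no edge of `T'` were cut by `s(a, b)`, a walk in `T'` from `a` to `b` would connect them in
  -- `T` without that edge.
  have hadj : ∀ x y, T'.Adj x y → (T.deleteEdges {s(a, b)}).Reachable x y := by
    intro x y hxy
    have := hcon s(x, y) hxy
    simp only [cutEdges, Finset.mem_filter, Finset.mem_univ, true_and, not_and, not_forall,
      not_not] at this
    obtain ⟨i, j, hij, hr⟩ := this hf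
    rcases Sym2.eq_iff.1 hij with ⟨rfl, rfl⟩ | ⟨rfl, rfl⟩
    · exact hr
    · exact hr.symm
  have hwalk : ∀ x y, T'.Walk x y → (T.deleteEdges {s(a, b)}).Reachable x y := by
    intro x y p
    induction p with
    | nil => exact SimpleGraph.Reachable.refl _
    | cons h p ih => exact (hadj _ _ h).trans ih
  obtain ⟨p⟩ := hT' a b
  have := (mem_edges_iff_not_reachable hT (SimpleGraph.Path.singleton (G := T) hf).2 s(a, b)).1
    (SimpleGraph.Path.mk'_mem_edges_singleton hf)
  exact this (hwalk a b p)

variable [Fintype V]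

open Classical in
-- Each edge of `T'` is expanded along its path in `T`, and the order of summation is exchanged.
theorem totalWeight_eq_sum_card_mul (hT : T.IsTree) (hdiag : ∀ i, ρ s(i, i) = 0)
    (hadd : ∀ (i j k : V) (p : T.Walk i j), p.IsPath → k ∈ p.support →
      ρ s(i, j) = ρ s(i, k) + ρ s(k, j)) (T' : SimpleGraph V) :
    totalWeight ρ T' = ∑ f : Sym2 V with f ∈ T.edgeSet,
      (Finset.card {e : Sym2 V | e ∈ T'.edgeSet ∧ f ∈ cutEdges T e} : ℝ) * ρ f := by
  unfold totalWeight
  rw [Finset.sum_congr rfl fun e _ => weight_eq_sum_cutEdges hT hdiag hadd e]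
  rw [Finset.sum_comm' (t' := Finset.univ.filter (· ∈ T.edgeSet))
    (s' := fun f => {e : Sym2 V | e ∈ T'.edgeSet ∧ f ∈ cutEdges T e})]
  · simp
  · intro e f
    simp only [Finset.mem_filter, Finset.mem_univ, true_and]
    refine ⟨fun h => ⟨h, ?_⟩, fun h => h.1⟩
    exact (Finset.mem_filter.1 h.2).2.1

theorem totalWeight_le_of_isTree (hT : T.IsTree) (hdiag : ∀ i, ρ s(i, i) = 0)
    (hadd : ∀ (i j k : V) (p : T.Walk i j), p.IsPath → k ∈ p.support →
      ρ s(i, j) = ρ s(i, k) + ρ s(k, j)) (hpos : ∀ i j, i ≠ j → 0 < ρ s(i, j))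
    {T' : SimpleGraph V} (hT' : T'.IsTree) :
    totalWeight ρ T ≤ totalWeight ρ T' ∧ (totalWeight ρ T' ≤ totalWeight ρ T → T' = T) := by
  classical
  have hposT : ∀ f ∈ T.edgeSet, 0 < ρ f := by
    intro f hf
    induction f with
    | _ a b => exact hpos a b (SimpleGraph.Adj.ne hf)
  have hn : ∀ f ∈ T.edgeSet,
      1 ≤ Finset.card {e : Sym2 V | e ∈ T'.edgeSet ∧ f ∈ cutEdges T e} := by
    intro f hf
    obtain ⟨e, he, hfe⟩ := exists_mem_cutEdges hT.isAcyclic hT'.connected hf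
    exact Finset.card_pos.2 ⟨e, by simp [he, hfe]⟩
  have hle : ∀ f ∈ Finset.univ.filter (· ∈ T.edgeSet), ρ f ≤
      (Finset.card {e : Sym2 V | e ∈ T'.edgeSet ∧ f ∈ cutEdges T e} : ℝ) * ρ f := by
    intro f hf
    have hf' : f ∈ T.edgeSet := (Finset.mem_filter.1 hf).2
    have h1 : (1 : ℝ) ≤ Finset.card {e : Sym2 V | e ∈ T'.edgeSet ∧ f ∈ cutEdges T e} := by
      exact_mod_cast hn f hf'
    nlinarith [hposT f hf']
  have hTT' := totalWeight_eq_sum_card_mul hT hdiag hadd T'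
  refine ⟨hTT' ▸ Finset.sum_le_sum hle, fun hge => ?_⟩
  have heq := (Finset.sum_eq_sum_iff_of_le hle).1
    (le_antisymm (Finset.sum_le_sum hle) (by rw [← hTT']; exact hge))
  have hone : ∀ f ∈ Finset.univ.filter (· ∈ T.edgeSet),
      Finset.card {e : Sym2 V | e ∈ T'.edgeSet ∧ f ∈ cutEdges T e} = 1 := by
    intro f hf
    have h1 := heq f hf
    have h2 := hposT f (Finset.mem_filter.1 hf).2
    have h3 : (Finset.card {e : Sym2 V | e ∈ T'.edgeSet ∧ f ∈ cutEdges T e} : ℝ) = 1 := by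
      refine mul_right_cancel₀ h2.ne' ?_
      rw [one_mul]
      exact h1.symm
    exact_mod_cast h3
  -- Double counting: with all multiplicities equal to `1`, the `T`-paths of the edges of `T'` have
  -- total length `|E(T)|`.
  have hcard : ∑ e : Sym2 V with e ∈ T'.edgeSet, (cutEdges T e).card =
      ∑ f : Sym2 V with f ∈ T.edgeSet, 1 := by
    rw [← Finset.sum_congr rfl hone]
    simp only [Finset.card_eq_sum_ones]
    refine Finset.sum_comm' ?_
    intro e f
    simp only [Finset.mem_filter, Finset.mem_univ, true_and]
    exact ⟨fun h => ⟨h, (Finset.mem_filter.1 h.2).2.1⟩, fun h => h.1⟩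
  have hcardT : ∀ G : SimpleGraph V, G.IsTree →
      ∑ f : Sym2 V with f ∈ G.edgeSet, 1 + 1 = Fintype.card V := by
    intro G hG
    rw [← hG.card_edgeFinset, Finset.sum_const, smul_eq_mul, mul_one]
    congr 2
    ext; simp
  have hpath : ∀ e ∈ Finset.univ.filter (· ∈ T'.edgeSet), 1 ≤ (cutEdges T e).card := by
    intro e he
    have he' := (Finset.mem_filter.1 he).2
    refine Finset.card_pos.2 (Finset.nonempty_iff_ne_empty.2 fun h0 => ?_)
    have h1 := weight_eq_sum_cutEdges hT hdiag hadd e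
    rw [h0, Finset.sum_empty] at h1
    induction e with
    | _ a b => exact (hpos a b (SimpleGraph.Adj.ne he')).ne' h1
  -- Both trees have `|V| - 1` edges, so path lengths that are at least `1` have average `1`, and
  -- each equals `1`.
  have hcone := (Finset.sum_eq_sum_iff_of_le hpath).1 (by
    rw [hcard]; have := hcardT T hT; have := hcardT T' hT'; omega)
  have hsub : T' ≤ T := by
    intro a b hab
    obtain ⟨p, hp, -⟩ := hT.existsUnique_path a b
    have h1 := hcone s(a, b) (by simpa using hab)
    rw [cutEdges_eq_toFinset hT.isAcyclic hp,
      List.toFinset_card_of_nodup hp.isTrail.edges_nodup, SimpleGraph.Walk.length_edges] at h1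
    exact SimpleGraph.Walk.adj_of_length_eq_one h1.symm
  exact le_antisymm hsub
    ((SimpleGraph.isTree_iff_minimal_connected.1 hT).2 hT'.connected hsub)

/-- For weights which are positive off the diagonal and additive along the paths of a tree, the
tree is the unique minimum spanning tree. -/
theorem isMinSpanningTree_iff_eq (hT : T.IsTree) (hdiag : ∀ i, ρ s(i, i) = 0)
    (hadd : ∀ (i j k : V) (p : T.Walk i j), p.IsPath → k ∈ p.support →
      ρ s(i, j) = ρ s(i, k) + ρ s(k, j)) (hpos : ∀ i j, i ≠ j → 0 < ρ s(i, j))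
    (T' : SimpleGraph V) : IsMinSpanningTree ρ T' ↔ T' = T := by
  constructor
  · rintro ⟨hT', hmin⟩
    exact (totalWeight_le_of_isTree hT hdiag hadd hpos hT').2 (hmin T hT)
  · rintro rfl
    exact ⟨hT, fun T'' hT'' => (totalWeight_le_of_isTree hT hdiag hadd hpos hT'').1⟩

end TreeMetric

/-! ### Separation in a tree by a vertex of a path. -/

section Separation

variable {V : Type*} {T : SimpleGraph V}

/-- A vertex `s` on the path from `i` to `j` in an acyclic graph separates the vertices joined to
`j` by a walk avoiding `s` from all the others, among which is `i`. -/
theorem exists_separates_of_mem_support (hT : T.IsAcyclic) {i j s : V} {p : T.Walk i j}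
    (hp : p.IsPath) (hs : s ∈ p.support) (hi : i ≠ s) (hj : j ≠ s) :
    ∃ A C : Set V, i ∈ A ∧ j ∈ C ∧ Disjoint A {s} ∧ Disjoint A C ∧ Disjoint {s} C ∧
      Separates T A {s} C ∧ ∀ m, m = s ∨ m ∈ A ∨ m ∈ C := by
  classical
  -- `C` is the component of `j` after removal of `s`. `A` gathers all the other components, so that
  -- every possible root `m` is covered.
  refine ⟨{x | x ≠ s ∧ ¬ ∃ q : T.Walk x j, s ∉ q.support}, {x | ∃ q : T.Walk x j, s ∉ q.support},
    ⟨hi, ?_⟩, ⟨.nil, by simpa using hj.symm⟩, ?_, ?_, ?_, ?_, ?_⟩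
  · rintro ⟨q, hq⟩
    have h : p = q.toPath := congrArg Subtype.val ((hT.subsingleton_path _ _).elim ⟨p, hp⟩ q.toPath)
    rw [h] at hs
    exact hq (q.support_toPath_subset_support hs)
  · rw [Set.disjoint_singleton_right]
    exact fun h => h.1 rfl
  · exact Set.disjoint_left.2 fun x hx hx' => hx.2 hx'
  · rw [Set.disjoint_singleton_left]
    rintro ⟨q, hq⟩
    exact hq q.start_mem_support
  · rintro a ha c ⟨q, hq⟩ r -
    refine ⟨s, ?_, rfl⟩
    by_contra hr
    refine ha.2 ⟨r.append q, ?_⟩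
    rw [SimpleGraph.Walk.mem_support_append_iff]
    tauto
  · intro m
    by_cases h1 : m = s
    · exact .inl h1
    · by_cases h2 : ∃ q : T.Walk m j, s ∉ q.support
      · exact .inr (.inr h2)
      · exact .inr (.inl ⟨h1, h2⟩)

theorem Separates.symm {A B C : Set V} (h : Separates T A B C) : Separates T C B A := by
  intro c hc a ha p hp
  obtain ⟨v, hv, hvB⟩ := h a ha c hc p.reverse hp.reverse
  exact ⟨v, by simpa using hv, hvB⟩

end Separation

end ExtremalTree

namespace ExtremalTree

/-! ### From conditional independence to independence of an increment. -/

section MarkovChain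

/-- If `X` and `Z` are conditionally independent given `W`, and a function of `(W, Z)` is
independent of `W`, then it is independent of `(W, X)`. -/
theorem indepFun_prodMk_of_condIndepFun {Ω α β γ δ : Type*} {mΩ : MeasurableSpace Ω}
    [StandardBorelSpace Ω] [MeasurableSpace α] [MeasurableSpace β] [MeasurableSpace γ]
    [MeasurableSpace δ] [StandardBorelSpace α] [Nonempty α] [StandardBorelSpace β] [Nonempty β]
    {μ : Measure Ω} [IsFiniteMeasure μ] {X : Ω → α} {Z : Ω → β} {W : Ω → γ}
    (hX : Measurable X) (hZ : Measurable Z) (hW : Measurable W) (h : X ⟂ᵢ[W, hW; μ] Z)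
    {φ : γ × β → δ} (hφ : Measurable φ) (hind : IndepFun W (fun ω => φ (W ω, Z ω)) μ) :
    IndepFun (fun ω => (W ω, X ω)) (fun ω => φ (W ω, Z ω)) μ := by
  rw [condIndepFun_iff_map_prod_eq_prod_condDistrib_prod_condDistrib hX hZ hW] at h
  rw [indepFun_iff_measure_inter_preimage_eq_mul] at hind ⊢
  intro G F hG hF
  have hD : MeasurableSet (φ ⁻¹' F) := hφ hF
  set c := μ ((fun ω => φ (W ω, Z ω)) ⁻¹' F) with hc
  -- Independence from `W` says that the conditional probability of `φ (W, Z) ∈ F` given `W` is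
  -- almost surely the constant `c`.
  have hconst : (fun w => condDistrib Z W μ w (Prod.mk w ⁻¹' (φ ⁻¹' F))) =ᵐ[μ.map W] fun _ => c := by
    refine ae_eq_of_forall_setLIntegral_eq_of_sigmaFinite
      (Kernel.measurable_kernel_prodMk_left hD) measurable_const ?_
    intro b hb _
    have h1 : (μ.map W ⊗ₘ condDistrib Z W μ) (b ×ˢ Set.univ ∩ φ ⁻¹' F) =
        ∫⁻ w in b, condDistrib Z W μ w (Prod.mk w ⁻¹' (φ ⁻¹' F)) ∂μ.map W := by
      rw [Measure.compProd_apply ((hb.prod MeasurableSet.univ).inter hD),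
        ← lintegral_indicator hb]
      refine lintegral_congr fun w => ?_
      by_cases hw : w ∈ b
      · simp [hw, Set.preimage_inter]
      · simp [hw, Set.preimage_inter]
    rw [← h1, compProd_map_condDistrib hZ.aemeasurable,
      Measure.map_apply (hW.prodMk hZ) ((hb.prod MeasurableSet.univ).inter hD), setLIntegral_const,
      Measure.map_apply hW hb, hc, mul_comm, ← hind b F hb hF]
    congr 1
    ext ω
    simp
  -- Conditional independence as a product of kernels. With `F' = φ ⁻¹' F` the second factor is the
  -- constant `c`; with `F' = univ` it is `1`.
  have key : ∀ F' : Set (γ × β), MeasurableSet F' →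
      μ ((fun ω => (W ω, X ω)) ⁻¹' G ∩ (fun ω => (W ω, Z ω)) ⁻¹' F') =
      ∫⁻ w, condDistrib X W μ w (Prod.mk w ⁻¹' G) * condDistrib Z W μ w (Prod.mk w ⁻¹' F')
        ∂μ.map W := by
    intro F' hF'
    have hS : MeasurableSet {q : γ × α × β | (q.1, q.2.1) ∈ G ∧ (q.1, q.2.2) ∈ F'} :=
      ((measurable_fst.prodMk measurable_snd.fst) hG).inter
        ((measurable_fst.prodMk measurable_snd.snd) hF')
    have h2 := DFunLike.congr_fun h {q : γ × α × β | (q.1, q.2.1) ∈ G ∧ (q.1, q.2.2) ∈ F'}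
    rw [Measure.map_apply (by fun_prop) hS, Measure.bind_apply hS (by fun_prop)] at h2
    refine Eq.trans ?_ (h2.trans (lintegral_congr fun w => ?_))
    · rfl
    · rw [Kernel.prod_apply' _ _ _ hS, Kernel.id_apply,
        lintegral_dirac' _ (measurable_measure_prodMk_left hS), Kernel.prod_apply,
        ← Measure.prod_prod]
      rfl
  calc μ ((fun ω => (W ω, X ω)) ⁻¹' G ∩ (fun ω => φ (W ω, Z ω)) ⁻¹' F)
      = ∫⁻ w, condDistrib X W μ w (Prod.mk w ⁻¹' G) * c ∂μ.map W := by
        refine (key (φ ⁻¹' F) hD).trans (lintegral_congr_ae ?_)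
        filter_upwards [hconst] with w hw
        rw [hw]
    _ = μ ((fun ω => (W ω, X ω)) ⁻¹' G) * c := by
        rw [lintegral_mul_const _ (Kernel.measurable_kernel_prodMk_left hG)]
        congr 1
        have := key Set.univ MeasurableSet.univ
        simpa using this.symm

end MarkovChain

end ExtremalTree

namespace ExtremalTree

theorem indepFun_iff_measureReal {Ω α β : Type*} [MeasurableSpace Ω] [MeasurableSpace α]
    [MeasurableSpace β] {μ : Measure Ω} [IsFiniteMeasure μ] {f : Ω → α} {g : Ω → β} :
    IndepFun f g μ ↔ ∀ s t, MeasurableSet s → MeasurableSet t →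
      μ.real (f ⁻¹' s ∩ g ⁻¹' t) = μ.real (f ⁻¹' s) * μ.real (g ⁻¹' t) := by
  rw [indepFun_iff_measure_inter_preimage_eq_mul]
  refine forall₄_congr fun s t _ _ => ?_
  rw [measureReal_def, measureReal_def, measureReal_def, ← ENNReal.toReal_mul,
    ENNReal.toReal_eq_toReal_iff' (measure_ne_top _ _)
      (ENNReal.mul_ne_top (measure_ne_top _ _) (measure_ne_top _ _))]

theorem measurable_quotient {V : Type*} (i s : V) : Measurable fun x : V → ℝ => x i / x s :=
  (measurable_pi_apply i).div (measurable_pi_apply s)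

theorem quotient_smul {V : Type*} {a : ℝ} (ha : 0 < a) (x : V → ℝ) (i s : V) :
    (a • x) i / (a • x) s = x i / x s := by
  simp only [Pi.smul_apply, smul_eq_mul]
  exact mul_div_mul_left _ _ ha.ne'

/-! ### Homogeneity, independent increments and the variogram of a multivariate Pareto vector. -/

section Pareto

open Filter Topology

theorem exceedanceLaw_eq_cond {V Ω : Type*} [MeasurableSpace Ω] {P : Measure Ω} {Y : Ω → V → ℝ}
    (hY : Measurable Y) (m : V) :
    exceedanceLaw P Y m = (P.map Y)[|{x | 1 < x m}] := by
  have hm : MeasurableSet {x : V → ℝ | 1 < x m} :=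
    measurableSet_lt measurable_const (measurable_pi_apply m)
  rw [exceedanceLaw, ProbabilityTheory.cond, ProbabilityTheory.cond, Measure.map_smul, Measure.map_apply hY hm,
    Measure.restrict_map hY hm]
  rfl

theorem measureReal_exceedanceLaw {V Ω : Type*} [MeasurableSpace Ω] {P : Measure Ω} {Y : Ω → V → ℝ}
    (hY : Measurable Y) (m : V) {S : Set (V → ℝ)} :
    (exceedanceLaw P Y m).real S =
      ((P.map Y).real {x | 1 < x m})⁻¹ * (P.map Y).real ({x | 1 < x m} ∩ S) := by
  have hm : MeasurableSet {x : V → ℝ | 1 < x m} :=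
    measurableSet_lt measurable_const (measurable_pi_apply m)
  rw [exceedanceLaw_eq_cond hY, measureReal_def, cond_apply hm, ENNReal.toReal_mul,
    ENNReal.toReal_inv]
  rfl

theorem ae_exceedanceLaw_iff {V Ω : Type*} [MeasurableSpace Ω] {P : Measure Ω}
    [IsProbabilityMeasure P] {Y : Ω → V → ℝ} (hY : Measurable Y) (m : V) {p : (V → ℝ) → Prop} :
    (∀ᵐ x ∂exceedanceLaw P Y m, p x) ↔ ∀ᵐ x ∂P.map Y, 1 < x m → p x := by
  have : IsProbabilityMeasure (P.map Y) := Measure.isProbabilityMeasure_map hY.aemeasurable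
  have hm : MeasurableSet {x : V → ℝ | 1 < x m} :=
    measurableSet_lt measurable_const (measurable_pi_apply m)
  rw [exceedanceLaw_eq_cond hY, ProbabilityTheory.cond,
    Measure.ae_ennreal_smul_measure_iff (ENNReal.inv_ne_zero.2 (measure_ne_top _ _)),
    ae_restrict_iff' hm]
  rfl

variable {V : Type*} [Fintype V] {Ω : Type*} [MeasurableSpace Ω] {P : Measure Ω} {Y : Ω → V → ℝ}

theorem ae_map_nonneg (hY : Measurable Y) (hP : IsMultivariatePareto P Y) :
    ∀ᵐ x ∂P.map Y, ∀ i, 0 ≤ x i := by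
  rw [ae_map_iff hY.aemeasurable (by measurability)]
  filter_upwards [hP.mem_supportSet] with ω hω using hω.1

theorem ae_exists_one_lt (hY : Measurable Y) (hP : IsMultivariatePareto P Y) :
    ∀ᵐ x ∂P.map Y, ∃ i, 1 < x i := by
  rw [ae_map_iff hY.aemeasurable (by measurability)]
  filter_upwards [hP.mem_supportSet] with ω hω
  by_contra! hcon
  refine absurd hω.2 (not_lt.2 ((pi_norm_le_iff_of_nonneg zero_le_one).2 fun i => ?_))
  rw [Real.norm_of_nonneg (hω.1 i)]
  exact hcon i

/-- Homogeneity for sets which need not be contained in the nonnegative orthant. -/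
theorem measureReal_inv_smul (hY : Measurable Y) (hP : IsMultivariatePareto P Y) {t : ℝ}
    (ht : 1 ≤ t) {A : Set (V → ℝ)} (hA : MeasurableSet A) (hA1 : ∀ x ∈ A, ∃ k, 1 < x k) :
    (P.map Y).real {x | t⁻¹ • x ∈ A} = t⁻¹ * (P.map Y).real A := by
  have ht0 : 0 < t := by linarith
  -- Homogeneity is given only inside `supportSet V`; cutting down to the orthant loses a null set,
  -- before and after scaling.
  set A' : Set (V → ℝ) := A ∩ {x | ∀ i, 0 ≤ x i} with hA'
  have hnn : MeasurableSet {x : V → ℝ | ∀ i, 0 ≤ x i} := by measurability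
  have hA'm : MeasurableSet A' := hA.inter hnn
  have hsub : A' ⊆ supportSet V := by
    rintro x ⟨hx, hx0⟩
    obtain ⟨k, hk⟩ := hA1 x hx
    refine ⟨hx0, hk.trans_le ?_⟩
    exact (le_abs_self _).trans (norm_le_pi_norm x k)
  have hsm : {x : V → ℝ | t⁻¹ • x ∈ A'} = t • A' := by
    ext x
    rw [Set.mem_smul_set_iff_inv_smul_mem₀ ht0.ne']
    rfl
  have h := hP.homogeneous t ht A' hA'm hsub
  have h1 : (P.map Y).real (t • A') = P.real {ω | Y ω ∈ t • A'} :=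
    map_measureReal_apply hY (hA'm.const_smul₀ t)
  have h2 : (P.map Y).real A' = P.real {ω | Y ω ∈ A'} := map_measureReal_apply hY hA'm
  rw [← h1, ← h2, ← hsm] at h
  have h3 : (P.map Y).real {x | t⁻¹ • x ∈ A'} = (P.map Y).real {x | t⁻¹ • x ∈ A} := by
    refine measureReal_congr ?_
    filter_upwards [ae_map_nonneg hY hP] with x hx
    refine propext ⟨fun h => h.1, fun h => ⟨h, fun i => ?_⟩⟩
    exact mul_nonneg (inv_nonneg.2 ht0.le) (hx i)
  have h4 : (P.map Y).real A' = (P.map Y).real A := by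
    refine measureReal_congr ?_
    filter_upwards [ae_map_nonneg hY hP] with x hx
    exact propext ⟨fun h => h.1, fun h => ⟨h, hx⟩⟩
  rw [← h3, h, h4]

/-- Scaling leaves the cone `D` alone and only moves the thresholds. The free level `c` allows the
choice `c = t⁻¹`, which trades the constraint `x s > t⁻¹` for `x s > 1`. -/
theorem measureReal_gt_inter_cone (hY : Measurable Y) (hP : IsMultivariatePareto P Y) {t : ℝ}
    (ht : 1 ≤ t) (m s : V) (c : ℝ) {D : Set (V → ℝ)} (hD : MeasurableSet D)
    (hcone : ∀ a : ℝ, 0 < a → ∀ x, a • x ∈ D ↔ x ∈ D) :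
    (P.map Y).real ({x | t < x m ∧ t * c < x s} ∩ D) =
      t⁻¹ * (P.map Y).real ({x | 1 < x m ∧ c < x s} ∩ D) := by
  have ht0 : 0 < t := by linarith
  rw [← measureReal_inv_smul hY hP ht (A := {x | 1 < x m ∧ c < x s} ∩ D)]
  · congr 1
    ext x
    simp only [Set.mem_inter_iff, Set.mem_ofPred_eq, hcone _ (inv_pos.2 ht0), Pi.smul_apply,
      smul_eq_mul, lt_inv_mul_iff₀ ht0, mul_one]
  · exact ((measurableSet_lt measurable_const (measurable_pi_apply m)).inter
      (measurableSet_lt measurable_const (measurable_pi_apply s))).inter hD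
  · exact fun x hx => ⟨m, hx.1.1⟩

variable [IsProbabilityMeasure P]

/-- If one component almost surely did not exceed `1`, equality of the margins would extend this to
all of them, and `Y` would leave `𝓛`. -/
theorem measureReal_one_lt_pos (hY : Measurable Y) (hP : IsMultivariatePareto P Y) (m : V) :
    0 < (P.map Y).real {x | 1 < x m} := by
  have : IsProbabilityMeasure (P.map Y) := Measure.isProbabilityMeasure_map hY.aemeasurable
  have hm : ∀ m, MeasurableSet {x : V → ℝ | 1 < x m} := fun m =>
    measurableSet_lt measurable_const (measurable_pi_apply m)
  rw [measureReal_nonneg.lt_iff_ne]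
  intro h0
  have hall : ∀ k, ∀ᵐ x ∂P.map Y, ¬ 1 < x k := by
    intro k
    have h1 : (P.map Y).real {x | 1 < x k} = 0 := by
      rw [map_measureReal_apply hY (hm k), h0, map_measureReal_apply hY (hm m)]
      exact hP.normalized k m
    rw [ae_iff]
    simpa using (measureReal_eq_zero_iff (by simp)).1 h1
  have h2 : ∀ᵐ x ∂P.map Y, False := by
    filter_upwards [ae_all_iff.2 hall, ae_exists_one_lt hY hP] with x hx ⟨k, hk⟩
    exact hx k hk
  exact IsProbabilityMeasure.ne_zero _ (ae_eq_bot.1 (eventually_false_iff_eq_bot.1 h2))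

theorem isProbabilityMeasure_exceedanceLaw (hY : Measurable Y) (hP : IsMultivariatePareto P Y)
    (m : V) : IsProbabilityMeasure (exceedanceLaw P Y m) := by
  have : IsProbabilityMeasure (P.map Y) := Measure.isProbabilityMeasure_map hY.aemeasurable
  rw [exceedanceLaw_eq_cond hY]
  refine cond_isProbabilityMeasure fun h => ?_
  have := measureReal_one_lt_pos hY hP m
  simp [measureReal_def, h] at this

/-- Given `Y_s > 1`, the quotient `Y_j / Y_s` is independent of `Y_s`. -/
theorem indepFun_quotient (hY : Measurable Y) (hP : IsMultivariatePareto P Y) (s j : V) :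
    IndepFun (fun x : V → ℝ => x s) (fun x => x j / x s) (exceedanceLaw P Y s) := by
  have := isProbabilityMeasure_exceedanceLaw hY hP s
  have hN := measureReal_one_lt_pos hY hP s
  have hR := measurable_quotient j s
  rw [indepFun_iff_measure_inter_preimage_eq_mul]
  intro B F hB hF
  set μ := exceedanceLaw P Y s
  set D := (fun x : V → ℝ => x j / x s) ⁻¹' F with hDdef
  have hD : MeasurableSet D := hR hF
  have hcone : ∀ a : ℝ, 0 < a → ∀ x, a • x ∈ D ↔ x ∈ D := by
    intro a ha x
    simp only [hDdef, Set.mem_preimage, quotient_smul ha]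
  -- It suffices to compare both measures on half-lines `(u, ∞)`. For `u ≥ 1` both sides scale by
  -- `u⁻¹`, as `D` is a cone; for `u ≤ 1` the constraint is void given `x s > 1`.
  have hext : (μ.restrict D).map (fun x => x s) = μ D • μ.map (fun x => x s) := by
    refine ext_of_generate_finite (Set.range Set.Ioi)
      (BorelSpace.measurable_eq.trans (borel_eq_generateFrom_Ioi ℝ)) isPiSystem_Ioi ?_ ?_
    · rintro _ ⟨u, rfl⟩
      rw [Measure.map_apply (measurable_pi_apply s) measurableSet_Ioi,
        Measure.restrict_apply ((measurable_pi_apply s) measurableSet_Ioi), Measure.smul_apply,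
        smul_eq_mul, Measure.map_apply (measurable_pi_apply s) measurableSet_Ioi,
        ← ENNReal.toReal_eq_toReal_iff' (measure_ne_top _ _)
          (ENNReal.mul_ne_top (measure_ne_top _ _) (measure_ne_top _ _)), ENNReal.toReal_mul]
      simp only [← measureReal_def]
      rw [measureReal_exceedanceLaw hY, measureReal_exceedanceLaw hY, measureReal_exceedanceLaw hY]
      rcases le_total 1 u with hu | hu
      · have h1 := measureReal_gt_inter_cone hY hP hu s s 1 hD hcone
        have h2 := measureReal_gt_inter_cone hY hP hu s s 1 MeasurableSet.univ (by simp)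
        have e1 : {x : V → ℝ | 1 < x s} ∩ ((fun x => x s) ⁻¹' Set.Ioi u ∩ D) =
            {x | u < x s ∧ u * 1 < x s} ∩ D := by
          ext x
          simp only [Set.mem_inter_iff, Set.mem_ofPred_eq, Set.mem_preimage, Set.mem_Ioi, mul_one,
            and_self]
          exact ⟨fun h => h.2, fun h => ⟨hu.trans_lt h.1, h⟩⟩
        have e2 : {x : V → ℝ | 1 < x s} ∩ ((fun x => x s) ⁻¹' Set.Ioi u) =
            {x | u < x s ∧ u * 1 < x s} ∩ Set.univ := by
          ext x
          simp only [Set.mem_inter_iff, Set.mem_ofPred_eq, Set.mem_preimage, Set.mem_Ioi, mul_one,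
            and_self, Set.mem_univ, and_true]
          exact ⟨fun h => h.2, fun h => ⟨hu.trans_lt h, h⟩⟩
        rw [e1, e2, h1, h2]
        simp only [and_self, Set.inter_univ]
        field_simp
      · have e1 : {x : V → ℝ | 1 < x s} ∩ ((fun x => x s) ⁻¹' Set.Ioi u ∩ D) =
            {x | 1 < x s} ∩ D := by
          ext x
          simp only [Set.mem_inter_iff, Set.mem_ofPred_eq, Set.mem_preimage, Set.mem_Ioi]
          exact ⟨fun h => ⟨h.1, h.2.2⟩, fun h => ⟨h.1, hu.trans_lt h.1, h.2⟩⟩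
        have e2 : {x : V → ℝ | 1 < x s} ∩ ((fun x => x s) ⁻¹' Set.Ioi u) =
            {x | 1 < x s} := by
          ext x
          simp only [Set.mem_inter_iff, Set.mem_ofPred_eq, Set.mem_preimage, Set.mem_Ioi]
          exact ⟨fun h => h.1, fun h => ⟨h, hu.trans_lt h⟩⟩
        rw [e1, e2]
        field_simp
    · simp [Measure.map_apply (measurable_pi_apply s) MeasurableSet.univ]
  have h := DFunLike.congr_fun hext B
  rwa [Measure.map_apply (measurable_pi_apply s) hB,
    Measure.restrict_apply ((measurable_pi_apply s) hB), Measure.smul_apply, smul_eq_mul,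
    Measure.map_apply (measurable_pi_apply s) hB, mul_comm] at h

/-- The independence of `Y_j / Y_s` from the part of `Y` separated from `Y_j` by `Y_s`, given
`Y_s > 1`. -/
theorem measureReal_markov_of_one_le (hY : Measurable Y) (hP : IsMultivariatePareto P Y)
    {A C : Set V} {s i j m : V} (hci : ExtremalCondIndep P Y A {s} C) (hi : i ∈ A) (hj : j ∈ C)
    (hm : m = s ∨ m ∈ A) {t : ℝ} {E F : Set ℝ} (hE : MeasurableSet E)
    (hF : MeasurableSet F) :
    (P.map Y).real ({x | t < x m ∧ 1 < x s} ∩ {x | x i / x s ∈ E ∧ x j / x s ∈ F}) *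
        (P.map Y).real {x | 1 < x s} =
      (P.map Y).real ({x | t < x m ∧ 1 < x s} ∩ {x | x i / x s ∈ E}) *
        (P.map Y).real ({x | 1 < x s} ∩ {x | x j / x s ∈ F}) := by
  have hN := measureReal_one_lt_pos hY hP s
  set W : (V → ℝ) → (({s} : Set V) → ℝ) := proj {s} with hWdef
  have hφ : Measurable fun q : (({s} : Set V) → ℝ) × (C → ℝ) => q.2 ⟨j, hj⟩ / q.1 ⟨s, rfl⟩ :=
    (measurable_snd.eval).div (measurable_fst.eval)
  have hind : IndepFun W (fun x => x j / x s) (exceedanceLaw P Y s) :=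
    (indepFun_quotient hY hP s j).comp (φ := fun r _ => r) (ψ := id)
      (measurable_pi_lambda _ fun _ => measurable_id) measurable_id |>.congr
      (.of_forall fun x => by
        funext ⟨v, hv⟩
        rw [Set.mem_singleton_iff] at hv
        subst hv
        rfl) (.of_forall fun x => rfl)
  -- The conditional independence enters only for the root `s`; other roots `m` are reached by
  -- scaling.
  have hind2 := indepFun_prodMk_of_condIndepFun (measurable_proj A) (measurable_proj C)
    (measurable_proj {s}) (hci s) hφ hind
  rw [indepFun_iff_measureReal] at hind2
  -- The event `t < x m` is a condition on `(Y_s, Y_A)` because `m = s` or `m ∈ A`.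
  obtain ⟨G, hG, hGeq⟩ : ∃ G : Set ((({s} : Set V) → ℝ) × (A → ℝ)), MeasurableSet G ∧
      (fun x => (W x, proj A x)) ⁻¹' G = {x | t < x m ∧ x i / x s ∈ E} := by
    have hq' : Measurable fun q : (({s} : Set V) → ℝ) × (A → ℝ) => q.2 ⟨i, hi⟩ / q.1 ⟨s, rfl⟩ :=
      (measurable_snd.eval).div (measurable_fst.eval)
    have hq : MeasurableSet {q : (({s} : Set V) → ℝ) × (A → ℝ) |
        q.2 ⟨i, hi⟩ / q.1 ⟨s, rfl⟩ ∈ E} := hq' hE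
    rcases hm with rfl | hm
    · exact ⟨{q | t < q.1 ⟨m, rfl⟩ ∧ q.2 ⟨i, hi⟩ / q.1 ⟨m, rfl⟩ ∈ E},
        (measurableSet_lt measurable_const measurable_fst.eval).inter hq, rfl⟩
    · exact ⟨{q | t < q.2 ⟨m, hm⟩ ∧ q.2 ⟨i, hi⟩ / q.1 ⟨s, rfl⟩ ∈ E},
        (measurableSet_lt measurable_const measurable_snd.eval).inter hq, rfl⟩
  have h := hind2 G F hG hF
  rw [hGeq, measureReal_exceedanceLaw hY, measureReal_exceedanceLaw hY,
    measureReal_exceedanceLaw hY] at h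
  have e1 : {x : V → ℝ | 1 < x s} ∩ ({x | t < x m ∧ x i / x s ∈ E} ∩
      (fun x => proj C x ⟨j, hj⟩ / proj {s} x ⟨s, rfl⟩) ⁻¹' F) =
      {x | t < x m ∧ 1 < x s} ∩ {x | x i / x s ∈ E ∧ x j / x s ∈ F} := by
    ext x
    simp only [Set.mem_inter_iff, Set.mem_ofPred_eq, Set.mem_preimage, proj]
    tauto
  have e2 : {x : V → ℝ | 1 < x s} ∩ {x | t < x m ∧ x i / x s ∈ E} =
      {x | t < x m ∧ 1 < x s} ∩ {x | x i / x s ∈ E} := by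
    ext x
    simp only [Set.mem_inter_iff, Set.mem_ofPred_eq]
    tauto
  rw [e1, e2] at h
  have e3 : (fun x : V → ℝ => proj C x ⟨j, hj⟩ / proj {s} x ⟨s, rfl⟩) ⁻¹' F =
      {x | x j / x s ∈ F} := rfl
  rw [e3] at h
  field_simp at h
  linarith

/-- Scaling by `n + 1` turns `{Y_m > 1, Y_s > 1/(n+1)}` into `{Y_m > n+1, Y_s > 1}`, where
`measureReal_markov_of_one_le` applies, and the factor `1/(n+1)` cancels from both sides. As `n → ∞`
these events exhaust `{Y_m > 1}` up to a null set, since `Y_s > 0` there. -/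
theorem measureReal_markov (hY : Measurable Y) (hP : IsMultivariatePareto P Y)
    {A C : Set V} {s i j m : V} (hci : ExtremalCondIndep P Y A {s} C) (hi : i ∈ A) (hj : j ∈ C)
    (hm : m = s ∨ m ∈ A) (hpos : ∀ᵐ x ∂P.map Y, 1 < x m → 0 < x s) {E F : Set ℝ}
    (hE : MeasurableSet E) (hF : MeasurableSet F) :
    (P.map Y).real ({x | 1 < x m} ∩ {x | x i / x s ∈ E ∧ x j / x s ∈ F}) *
        (P.map Y).real {x | 1 < x s} =
      (P.map Y).real ({x | 1 < x m} ∩ {x | x i / x s ∈ E}) *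
        (P.map Y).real ({x | 1 < x s} ∩ {x | x j / x s ∈ F}) := by
  have : IsProbabilityMeasure (P.map Y) := Measure.isProbabilityMeasure_map hY.aemeasurable
  have hlim : ∀ D : Set (V → ℝ), Tendsto
      (fun n : ℕ => (P.map Y).real ({x | 1 < x m ∧ ((n : ℝ) + 1)⁻¹ < x s} ∩ D)) atTop
      (𝓝 ((P.map Y).real ({x | 1 < x m} ∩ D))) := by
    intro D
    have hmono : Monotone fun n : ℕ => {x : V → ℝ | 1 < x m ∧ ((n : ℝ) + 1)⁻¹ < x s} ∩ D := by
      intro a b hab x hx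
      refine ⟨⟨hx.1.1, lt_of_le_of_lt ?_ hx.1.2⟩, hx.2⟩
      have : (a : ℝ) ≤ b := by exact_mod_cast hab
      gcongr
    have h1 := tendsto_measure_iUnion_atTop (μ := P.map Y) hmono
    have h2 : (P.map Y) (⋃ n : ℕ, {x : V → ℝ | 1 < x m ∧ ((n : ℝ) + 1)⁻¹ < x s} ∩ D) =
        (P.map Y) ({x | 1 < x m} ∩ D) := by
      refine measure_congr ?_
      filter_upwards [hpos] with x hx
      refine propext ?_
      change (x ∈ ⋃ n : ℕ, {x : V → ℝ | 1 < x m ∧ ((n : ℝ) + 1)⁻¹ < x s} ∩ D) ↔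
        x ∈ {x | 1 < x m} ∩ D
      simp only [Set.mem_iUnion, Set.mem_inter_iff, Set.mem_ofPred_eq]
      refine ⟨fun ⟨n, h⟩ => ⟨h.1.1, h.2⟩, fun h => ?_⟩
      obtain ⟨n, hn⟩ := exists_nat_one_div_lt (hx h.1)
      exact ⟨n, ⟨h.1, by rwa [one_div] at hn⟩, h.2⟩
    rw [h2] at h1
    exact (ENNReal.tendsto_toReal (measure_ne_top _ _)).comp h1
  have hEm := measurable_quotient i s hE
  have hFm := measurable_quotient j s hF
  have hcE : ∀ a : ℝ, 0 < a → ∀ x : V → ℝ, a • x ∈ {x : V → ℝ | x i / x s ∈ E} ↔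
      x ∈ {x : V → ℝ | x i / x s ∈ E} := by
    intro a ha x
    simp only [Set.mem_ofPred_eq, quotient_smul ha]
  have hcEF : ∀ a : ℝ, 0 < a → ∀ x : V → ℝ,
      a • x ∈ {x : V → ℝ | x i / x s ∈ E ∧ x j / x s ∈ F} ↔
      x ∈ {x : V → ℝ | x i / x s ∈ E ∧ x j / x s ∈ F} := by
    intro a ha x
    simp only [Set.mem_ofPred_eq, quotient_smul ha]
  refine tendsto_nhds_unique ((hlim _).mul_const _) ?_
  refine ((hlim _).mul_const _).congr fun n => ?_
  have hn : (1 : ℝ) ≤ n + 1 := by linarith [(Nat.cast_nonneg n : (0 : ℝ) ≤ n)]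
  have hn0 : (0 : ℝ) < n + 1 := by linarith
  have h := measureReal_markov_of_one_le hY hP hci hi hj hm (t := n + 1) hE hF
  have h1 := measureReal_gt_inter_cone hY hP hn m s ((n : ℝ) + 1)⁻¹ hEm hcE
  have h2 := measureReal_gt_inter_cone hY hP hn m s ((n : ℝ) + 1)⁻¹ (hEm.inter hFm) hcEF
  rw [mul_inv_cancel₀ hn0.ne'] at h1 h2
  have e1 : (fun x : V → ℝ => x i / x s) ⁻¹' E = {x | x i / x s ∈ E} := rfl
  have e2 : (fun x : V → ℝ => x i / x s) ⁻¹' E ∩ (fun x : V → ℝ => x j / x s) ⁻¹' F =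
    {x | x i / x s ∈ E ∧ x j / x s ∈ F} := rfl
  rw [e1] at h1
  rw [e2] at h2
  rw [h1, h2, mul_assoc, mul_assoc] at h
  exact (mul_left_cancel₀ (inv_pos.2 hn0).ne' h).symm

/-- If `s` separates `i` from `j`, the increments `Y_i / Y_s` and `Y_j / Y_s` are independent given
`Y_m > 1`. -/
theorem indepFun_quotients (hY : Measurable Y) (hP : IsMultivariatePareto P Y)
    {A C : Set V} {s i j m : V} (hci : ExtremalCondIndep P Y A {s} C) (hi : i ∈ A) (hj : j ∈ C)
    (hm : m = s ∨ m ∈ A) (hpos : ∀ᵐ x ∂P.map Y, 1 < x m → 0 < x s) :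
    IndepFun (fun x : V → ℝ => x i / x s) (fun x => x j / x s) (exceedanceLaw P Y m) := by
  rw [indepFun_iff_measureReal]
  intro E F hE hF
  rw [measureReal_exceedanceLaw hY, measureReal_exceedanceLaw hY, measureReal_exceedanceLaw hY]
  have hN := measureReal_one_lt_pos hY hP s
  have hM := measureReal_one_lt_pos hY hP m
  have h1 := measureReal_markov hY hP hci hi hj hm hpos hE hF
  -- With `E = univ` the identity says that `Y_j / Y_s` has the same law given `Y_m > 1` as given
  -- `Y_s > 1`.
  have h2 := measureReal_markov hY hP hci hi hj hm hpos MeasurableSet.univ hF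
  simp only [Set.mem_univ, true_and, Set.ofPred_true, Set.inter_univ] at h2
  have e : {x : V → ℝ | 1 < x m} ∩ ((fun x : V → ℝ => x i / x s) ⁻¹' E ∩
      (fun x : V → ℝ => x j / x s) ⁻¹' F) =
      {x | 1 < x m} ∩ {x | x i / x s ∈ E ∧ x j / x s ∈ F} := rfl
  have e1 : (fun x : V → ℝ => x i / x s) ⁻¹' E = {x | x i / x s ∈ E} := rfl
  have e2 : (fun x : V → ℝ => x j / x s) ⁻¹' F = {x | x j / x s ∈ F} := rfl
  rw [e, e1, e2]
  rw [← eq_div_iff hN.ne'] at h1 h2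
  rw [h1, h2]
  field_simp

/-- `log Y_i - log Y_j` is the difference of the independent increments `log (Y_i / Y_s)` and `log
(Y_j / Y_s)`, so the covariance term vanishes. -/
theorem extremalVariogram_add_of_condIndep (hY : Measurable Y) (hP : IsMultivariatePareto P Y)
    {A C : Set V} {s i j m : V} (hci : ExtremalCondIndep P Y A {s} C) (hi : i ∈ A) (hj : j ∈ C)
    (hm : m = s ∨ m ∈ A) (hex : VariogramExists P Y m) :
    extremalVariogram P Y m i j = extremalVariogram P Y m i s + extremalVariogram P Y m s j := by
  have hpos := (hex s s).1.mono fun x hx => hx.1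
  have hpos' := (ae_exceedanceLaw_iff hY m).1 hpos
  have hlog : ∀ k, (Real.log ∘ fun x : V → ℝ => x k / x s) =ᵐ[exceedanceLaw P Y m]
      fun x => Real.log (x k) - Real.log (x s) := by
    intro k
    filter_upwards [(hex k s).1] with x hx
    exact Real.log_div hx.1.ne' hx.2.ne'
  have hind := ((indepFun_quotients hY hP hci hi hj hm hpos').comp Real.measurable_log
    Real.measurable_log).congr (hlog i) (hlog j)
  rw [extremalVariogram_symm P Y m s j]
  have hcov := hind.covariance_eq_zero (hex i s).2 (hex j s).2
  have hsub := variance_sub (hex i s).2 (hex j s).2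
  rw [hcov, mul_zero, sub_zero] at hsub
  unfold extremalVariogram
  rw [← hsub]
  congr 1
  ext x
  simp

/-- The extremal variogram of an extremal tree model is additive along paths. -/
theorem extremalVariogram_add_of_mem_support (hY : Measurable Y) {T : SimpleGraph V}
    (hT : T.IsAcyclic) (hmodel : IsExtremalGraphicalModel P Y T) {m : V}
    (hex : VariogramExists P Y m) {i j s : V} {p : T.Walk i j} (hp : p.IsPath)
    (hs : s ∈ p.support) :
    extremalVariogram P Y m i j = extremalVariogram P Y m i s + extremalVariogram P Y m s j := by
  have hself : ∀ k, extremalVariogram P Y m k k = 0 := by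
    intro k
    have : (fun x : V → ℝ => Real.log (x k) - Real.log (x k)) = 0 := by ext x; simp
    rw [extremalVariogram, this, variance_zero]
  by_cases hi : i = s
  · rw [← hi, hself, zero_add]
  by_cases hj : j = s
  · rw [← hj, hself, add_zero]
  obtain ⟨A, C, hiA, hjC, hAs, hAC, hsC, hsep, hall⟩ :=
    exists_separates_of_mem_support hT hp hs hi hj
  -- A root in `C` is handled by exchanging `i` with `j` and `A` with `C`.
  have hcase : (m = s ∨ m ∈ A) ∨ m ∈ C := by
    rcases hall m with h | h | h <;> tauto
  rcases hcase with h | h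
  · exact extremalVariogram_add_of_condIndep hY hmodel.pareto
      (hmodel.globalMarkov A {s} C hAs hAC hsC hsep) hiA hjC h hex
  · rw [extremalVariogram_symm P Y m i j, extremalVariogram_symm P Y m i s,
      extremalVariogram_symm P Y m s j, add_comm]
    exact extremalVariogram_add_of_condIndep hY hmodel.pareto
      (hmodel.globalMarkov C {s} A hsC.symm hAC.symm hAs.symm hsep.symm) hjC hiA (.inr h) hex

/-- A proportionality `Y_i = c Y_j` on the event `Y_m > 1` holds almost surely, and forces
`Y_i = Y_j`. -/
theorem ae_eq_of_proportional (hY : Measurable Y) (hP : IsMultivariatePareto P Y) {m i j : V}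
    (hpos : ∀ k, ∀ᵐ x ∂P.map Y, 1 < x k → 0 < x m) {c : ℝ} (hc : 0 < c)
    (hprop : ∀ᵐ x ∂P.map Y, 1 < x m → x i = c * x j) : ∀ᵐ x ∂P.map Y, x i = x j := by
  have : IsProbabilityMeasure (P.map Y) := Measure.isProbabilityMeasure_map hY.aemeasurable
  set D : Set (V → ℝ) := {x | x i ≠ c * x j} with hDdef
  have hD : MeasurableSet D :=
    (measurableSet_eq_fun (measurable_pi_apply i) (measurable_const.mul (measurable_pi_apply j))).compl
  have hcone : ∀ a : ℝ, 0 < a → ∀ x, a • x ∈ D ↔ x ∈ D := by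
    intro a ha x
    simp only [hDdef, Set.mem_ofPred_eq, Pi.smul_apply, smul_eq_mul, ne_eq, mul_left_comm c a,
      mul_right_inj' ha.ne']
  have hprop' : ∀ᵐ x ∂P.map Y, x i = c * x j := by
    -- Scaled by `n + 1`, this event lies in `{x m > 1} ∩ D`, which is null by `hprop`. Almost every
    -- `x` has some `x k > 1`, hence `x m > 0`, and falls under some pair `(k, n)` if it lies in
    -- `D`.
    have hn : ∀ (k : V) (n : ℕ), ∀ᵐ x ∂P.map Y, ¬ (x ∈ {x : V → ℝ | 1 < x k ∧
        ((n : ℝ) + 1)⁻¹ < x m} ∩ D) := by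
      intro k n
      have hn : (1 : ℝ) ≤ n + 1 := by linarith [(Nat.cast_nonneg n : (0 : ℝ) ≤ n)]
      have hn0 : (0 : ℝ) < n + 1 := by linarith
      have h := measureReal_gt_inter_cone hY hP hn k m ((n : ℝ) + 1)⁻¹ hD hcone
      rw [mul_inv_cancel₀ hn0.ne'] at h
      have h0 : (P.map Y).real ({x | (n : ℝ) + 1 < x k ∧ 1 < x m} ∩ D) = 0 := by
        rw [measureReal_eq_zero_iff]
        refine measure_mono_null ?_ (ae_iff.1 hprop)
        rintro x ⟨⟨-, hx⟩, hxD⟩ hx'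
        exact hxD (hx' hx)
      rw [h0, eq_comm, mul_eq_zero, or_iff_right (inv_pos.2 hn0).ne', measureReal_eq_zero_iff] at h
      exact measure_eq_zero_iff_ae_notMem.1 h
    filter_upwards [ae_exists_one_lt hY hP, ae_all_iff.2 hpos,
      ae_all_iff.2 fun k => ae_all_iff.2 (hn k)] with x ⟨k, hk⟩ hpos hn
    by_contra hne
    obtain ⟨n, h⟩ := exists_nat_one_div_lt (hpos k hk)
    exact hn k n ⟨⟨hk, by rwa [one_div] at h⟩, hne⟩
  have hmarg : ∀ (k : V) (t : ℝ), 1 ≤ t → (P.map Y).real {x | t < x k} =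
      t⁻¹ * (P.map Y).real {x | 1 < x k} := by
    intro k t ht
    have := measureReal_gt_inter_cone hY hP ht k k 1 MeasurableSet.univ (by simp)
    simpa using this
  have hnorm : (P.map Y).real {x | 1 < x i} = (P.map Y).real {x | 1 < x j} := by
    have hm : ∀ m, MeasurableSet {x : V → ℝ | 1 < x m} := fun m =>
      measurableSet_lt measurable_const (measurable_pi_apply m)
    rw [map_measureReal_apply hY (hm i), map_measureReal_apply hY (hm j)]
    exact hP.normalized i j
  have hNj := measureReal_one_lt_pos hY hP j
  -- With `p` the common value of `ℙ(Y_k > 1)`: if `c ≤ 1`, then `p = ℙ(Y_i > 1) = ℙ(Y_j > c⁻¹) = c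
  -- p`; if `c ≥ 1`, then `p = ℙ(Y_j > 1) = ℙ(Y_i > c) = c⁻¹ p`. The cases differ because tails
  -- scale only from levels at least `1`.
  have hc1 : c = 1 := by
    rcases le_total c 1 with h | h
    · have h1 := hmarg j c⁻¹ ((one_le_inv₀ hc).2 h)
      have h2 : (P.map Y).real {x | c⁻¹ < x j} = (P.map Y).real {x | 1 < x i} := by
        refine measureReal_congr ?_
        filter_upwards [hprop'] with x hx
        refine propext ?_
        change c⁻¹ < x j ↔ 1 < x i
        rw [hx, inv_lt_iff_one_lt_mul₀' hc]
      rw [h2, hnorm, inv_inv] at h1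
      exact (mul_right_cancel₀ hNj.ne' ((one_mul _).trans h1)).symm
    · have h1 := hmarg i c h
      have h2 : (P.map Y).real {x | c < x i} = (P.map Y).real {x | 1 < x j} := by
        refine measureReal_congr ?_
        filter_upwards [hprop'] with x hx
        refine propext ?_
        change c < x i ↔ 1 < x j
        rw [hx, lt_mul_iff_one_lt_right hc]
      rw [h2, hnorm] at h1
      have h3 := mul_right_cancel₀ hNj.ne' ((one_mul _).trans h1)
      rw [← inv_inv c, ← h3, inv_one]
  filter_upwards [hprop'] with x hx
  rw [hx, hc1, one_mul]

theorem measure_ne_pos_iff (hY : Measurable Y) (hP : IsMultivariatePareto P Y)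
    (hex : ∀ m, VariogramExists P Y m) (m i j : V) :
    0 < P {ω | Y ω i ≠ Y ω j} ↔ 0 < extremalVariogram P Y m i j := by
  have := isProbabilityMeasure_exceedanceLaw hY hP m
  have heq : (P {ω | Y ω i ≠ Y ω j} = 0) ↔ ∀ᵐ x ∂P.map Y, x i = x j := by
    rw [ae_map_iff hY.aemeasurable
      (measurableSet_eq_fun (measurable_pi_apply i) (measurable_pi_apply j)), ae_iff]
  have hnonneg : 0 ≤ extremalVariogram P Y m i j := variance_nonneg _ _
  rw [pos_iff_ne_zero, hnonneg.lt_iff_ne', not_iff_not, heq]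
  constructor
  · intro h
    have h1 : (fun x : V → ℝ => Real.log (x i) - Real.log (x j)) =ᵐ[exceedanceLaw P Y m] 0 := by
      rw [EventuallyEq, ae_exceedanceLaw_iff hY]
      filter_upwards [h] with x hx _
      simp [hx]
    rw [extremalVariogram, variance_congr h1, variance_zero]
  · intro h
    have h1 := ae_eq_integral_of_variance_eq_zero (hex m i j).2 h
    set a := ∫ x, (Real.log (x i) - Real.log (x j)) ∂exceedanceLaw P Y m
    have h2 : ∀ᵐ x ∂exceedanceLaw P Y m, x i = Real.exp a * x j := by
      filter_upwards [h1, (hex m i j).1] with x hx hx'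
      rw [← hx, Real.exp_sub, Real.exp_log hx'.1, Real.exp_log hx'.2,
        div_mul_cancel₀ _ hx'.2.ne']
    -- Existence of `Γ^(k)` for every root `k` gives `Y_m > 0` on each event `{Y_k > 1}`, hence
    -- almost surely.
    exact ae_eq_of_proportional hY hP
      (fun k => (ae_exceedanceLaw_iff hY k).1 ((hex k m m).1.mono fun x hx => hx.1))
      (Real.exp_pos a) ((ae_exceedanceLaw_iff hY m).1 h2)

end Pareto

end ExtremalTree

theorem mainTheorem3 {V : Type*} [Fintype V] {Ω : Type*} [MeasurableSpace Ω]
    (P : Measure Ω) [IsProbabilityMeasure P] (Y : Ω → V → ℝ) (hY : Measurable Y)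
    (T : SimpleGraph V) (hT : T.IsTree)
    (hmodel : ExtremalTree.IsExtremalGraphicalModel P Y T)
    (hexists : ∀ m : V, ExtremalTree.VariogramExists P Y m) :
    (∀ m i j : V, i ≠ j →
      (0 < P {ω | Y ω i ≠ Y ω j} ↔ 0 < ExtremalTree.extremalVariogram P Y m i j)) ∧
    ((∀ i j : V, i ≠ j → 0 < P {ω | Y ω i ≠ Y ω j}) →
      ∀ (m : V) (T' : SimpleGraph V),
        ExtremalTree.IsMinSpanningTree (ExtremalTree.variogramWeight P Y m) T' ↔ T' = T) := by
  have hpos := fun m i j => ExtremalTree.measure_ne_pos_iff hY hmodel.pareto hexists m i j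
  refine ⟨fun m i j _ => hpos m i j, fun hne m T' => ?_⟩
  refine ExtremalTree.isMinSpanningTree_iff_eq hT (fun i => ?_) (fun i j k p hp hk => ?_)
    (fun i j hij => (hpos m i j).1 (hne i j hij)) T'
  · simp [ExtremalTree.variogramWeight, ExtremalTree.extremalVariogram,
      ← Pi.zero_def, variance_zero]
  · exact ExtremalTree.extremalVariogram_add_of_mem_support hY hT.isAcyclic hmodel (hexists m) hp hk
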